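/- Let $T\subset\mathbb R^d$ be a $d$-simplex with vertices $\mathtt v_0,\dots,\mathtt v_d$ in general position and barycentric coordinates $\lambda_0,\dots,\lambda_d$ (affine functions with $\lambda_i(\mathtt v_j)=\delta_{ij}$), let $0\le k\le d-1$ and $r\ge 1$. Notation. $\Delta_\ell(T)$ is the set of $\ell$-dimensional sub-simplices of $T$; a sub-simplex $f$ is identified with the set of indices of its vertices, and $\mathscr T^f\subseteq\mathbb R^d$ is its tangent plane. $\Sigma(m,n)$ is the set of increasing sequences $\sigma:\{1,\dots,m\}\to\{1,\dots,n\}$. For $u\in\mathbb R^d$, $\mathrm d_\flat u$ is the covector $v\mapsto u\cdot v$. For every $e\in\Delta_s(T)$ fix a basis $t^e_1,\dots,t^e_s$ of $\mathscr T^e$ and put $\mathrm d_\flat t^e_\sigma=\mathrm d_\flat t^e_{\sigma(1)}\wedge\cdots\wedge \mathrm d_\flat t^e_{\sigma(m)}$ for $\sigma\in\Sigma(m,s)$. For $i\in f$ let $\mathrm d_f\lambda_i=\mathrm d_\flat(\nabla_f\lambda_i)$, where $\nabla_f\lambda_i$ is the orthogonal projection of $\nabla\lambda_i$ to $\mathscr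 T^f$. For sub-simplices $e\subseteq f$, where $e$ has dimension $s$ and $f$ has dimension $\ell$, let $i_1<\dots<i_{\ell-s}$ be the elements of $f\setminus e$ and put $$\mathrm d\lambda_{[f\setminus e]}=\mathrm d\lambda_{i_1}\wedge\cdots\wedge \mathrm d\lambda_{i_{\ell-s}},\qquad \mathrm d_f\widehat\lambda_{[f\setminus e]}=\mathrm d_{e\cup\{i_1\}}\lambda_{i_1}\wedge\cdots\wedge \mathrm d_{e\cup\{i_{\ell-s}\}}\lambda_{i_{\ell-s}} .$$ $\mathbb P_j(\Omega)$ is the space of restrictions to $\Omega$ of real polynomials of degree at most $j$, with $\mathbb P_j(\Omega)=\{0\}$ for $j<0$; $\mathbb P_r\Lambda^k(T)=\mathbb P_r(T)\otimes\operatorname{Alt}^k(\mathbb R^d)$; and $b_e=\prod_{i\in e}\lambda_i$. In a product $b_e\mathbb P_j(e)$, the space $\mathbb P_j(e)$ is extended to $T$ in Bernstein form, as the span of the monomials $\prod_{i\in e}\lambda_i^{\alpha_i}$ with $\sum_{i\in e}\alpha_i=j$. The inner product $\langle\cdot,\cdot\rangle$ on $\operatorname{Alt}^k(\mathbb R^d)$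 is the one induced by the Euclidean inner product, and $\mathrm ds$ is the $s$-dimensional surface measure on $e\in\Delta_s(T)$ (the unit point mass if $s=0$). Theorem. (1) There is the direct sum decomposition $$\mathbb P_r\Lambda^k(T)=\bigoplus_{s=0}^d\ \bigoplus_{e\in\Delta_s(T)}\ \bigoplus_{\ell=\max\{s,k\}}^{\min\{k+s,d\}}\ \bigoplus_{f\in\Delta_\ell(T),\,e\subseteq f}\ \bigoplus_{\sigma\in\Sigma(s+k-\ell,s)} b_e\,\mathbb P_{r-(s+1)}(e)\;\mathrm d_\flat t^e_\sigma\wedge \mathrm d\lambda_{[f\setminus e]} .$$ (2) Every $\omega\in\mathbb P_r\Lambda^k(T)$ is uniquely determined by the degrees of freedom $$\int_e\langle\omega,\ \mathrm d_\flat t^e_\sigma\wedge \mathrm d_f\widehat\lambda_{[f\setminus e]}\rangle\,q\,\mathrm ds,\qquad q\in\mathbb P_{r-(s+1)}(e),\ \sigma\in\Sigma(s+k-\ell,s),$$ where $f$ ranges over $\Delta_\ell(T)$ for $k\le\ell\le d$ and $e\subseteq f$ ranges over the sub-simplices of $f$ of dimension $s$ with $\ell-k\le s\le\ell$. That is, two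 elements of $\mathbb P_r\Lambda^k(T)$ with the same degrees of freedom are equal; moreover, for every choice of linear functionals $L_{e,f,\sigma}$ on $\mathbb P_{r-(s+1)}(e)$ there is an $\omega\in\mathbb P_r\Lambda^k(T)$ with $\int_e\langle\omega, \mathrm d_\flat t^e_\sigma\wedge \mathrm d_f\widehat\lambda_{[f\setminus e]}\rangle\,q\,\mathrm ds=L_{e,f,\sigma}(q)$ for all $e,f,\sigma,q$. -/

import Mathlib

open MeasureTheory

namespace GeoDec

noncomputable section

/-- `ℝ^d` with its Euclidean structure. -/
abbrev E (d : ℕ) : Type := EuclideanSpace ℝ (Fin d)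

/-- `Alt^k(ℝ^d)`: alternating `k`-linear functionals on `ℝ^d`. -/
abbrev Alt (d k : ℕ) : Type := E d [⋀^Fin k]→ₗ[ℝ] ℝ

/-- A `d`-simplex in `ℝ^d` given by its (affinely independent) vertices `v_0, …, v_d`. -/
abbrev Simp (d : ℕ) : Type := Affine.Simplex ℝ (E d) d

/-! ### Sub-simplices, barycentric coordinates, tangent planes

A sub-simplex of `T` is encoded by the set of indices of its vertices, a nonempty subset of
`{0, …, d}`; its dimension is its cardinality minus one. -/

/-- The geometric realization of `e`: the convex hull of its vertices. -/
def geom {d : ℕ} (T : Simp d) (e : Finset (Fin (d + 1))) : Set (E d) :=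
  convexHull ℝ (T.points '' (e : Set (Fin (d + 1))))

/-- The vertices of `T` as an affine basis of `ℝ^d`. -/
def affBasis {d : ℕ} (T : Simp d) : AffineBasis (Fin (d + 1)) ℝ (E d) where
  toFun := T.points
  ind' := T.independent
  tot' := by
    rw [T.independent.affineSpan_eq_top_iff_card_eq_finrank_add_one]
    simp

/-- The barycentric coordinate `λ_i`, an affine function on `ℝ^d`. -/
def bary {d : ℕ} (T : Simp d) (i : Fin (d + 1)) : E d →ᵃ[ℝ] ℝ :=
  (affBasis T).coord i

/-- The tangent plane `𝒯^e`, spanned by the differences of the vertices of `e`. -/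
def tangent {d : ℕ} (T : Simp d) (e : Finset (Fin (d + 1))) : Submodule ℝ (E d) :=
  vectorSpan ℝ (T.points '' (e : Set (Fin (d + 1))))

/-! ### Covectors and wedge products -/

/-- `d♭ u = u^♭ : v ↦ u · v`. -/
def flat {d : ℕ} (u : E d) : Module.Dual ℝ (E d) :=
  (innerSL ℝ u : E d →ₗ[ℝ] ℝ)

/-- `dλ_i`, the (constant) differential of the affine function `λ_i`. -/
def dBary {d : ℕ} (T : Simp d) (i : Fin (d + 1)) : Module.Dual ℝ (E d) :=
  (bary T i).linear

/-- `d_f λ_i` for a sub-simplex `f`: the differential of `λ_i` along `𝒯^f`, extended to `ℝ^d` by the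
orthogonal projection `Π_f : ℝ^d → 𝒯^f`. Equivalently, the flat of the surface gradient
`∇_f λ_i = Π_f ∇ λ_i`. -/
def dFaceBary {d : ℕ} (T : Simp d) (f : Finset (Fin (d + 1))) (i : Fin (d + 1)) :
    Module.Dual ℝ (E d) :=
  dBary T i ∘ₗ ((tangent T f).starProjection : E d →ₗ[ℝ] E d)

/-- The wedge product of `k` covectors:
`(φ_1 ∧ ⋯ ∧ φ_k)(v_1, …, v_k) = det (φ_i (v_j))`; it is `1` for `k = 0`. -/
def wedge {d k : ℕ} (φ : Fin k → Module.Dual ℝ (E d)) : Alt d k :=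
  (Matrix.detRowAlternating (n := Fin k) (R := ℝ)).compLinearMap (LinearMap.pi φ)

/-- The inner product on `Alt^k(ℝ^d)`: the sum over increasing sequences `σ` of
`ω(e_{σ(1)}, …, e_{σ(k)}) η(e_{σ(1)}, …, e_{σ(k)})`, with `e_1, …, e_d` the standard basis. -/
def altInner {d k : ℕ} (ω η : Alt d k) : ℝ :=
  ∑ σ : Fin k ↪o Fin d,
    ω (fun i => EuclideanSpace.basisFun (Fin d) ℝ (σ i)) *
      η (fun i => EuclideanSpace.basisFun (Fin d) ℝ (σ i))

/-! ### Polynomials -/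

/-- Evaluation of polynomials in `d` variables as functions on `ℝ^d`. -/
def evalPoly (d : ℕ) : MvPolynomial (Fin d) ℝ →ₗ[ℝ] (E d → ℝ) :=
  LinearMap.pi fun x => (MvPolynomial.aeval (fun i => x i)).toLinearMap

/-- `P_j = P_j(ℝ^d)`: polynomial functions of total degree at most `j`, and `{0}` for `j < 0`. -/
def Poly (d : ℕ) (j : ℤ) : Submodule ℝ (E d → ℝ) :=
  if 0 ≤ j then (MvPolynomial.restrictTotalDegree (Fin d) ℝ j.toNat).map (evalPoly d) else ⊥

/-- `P_j(Ω)`: the functions on `Ω` that are restrictions of polynomials in `P_j(ℝ^d)`. -/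
def PolyOn {d : ℕ} (Ω : Set (E d)) (j : ℤ) : Submodule ℝ (Ω → ℝ) :=
  (Poly d j).map (LinearMap.funLeft ℝ ℝ (Subtype.val : Ω → E d))

/-- The natural extension of `P_j(e)` to polynomials on `ℝ^d`, by means of the Bernstein form: the
span of the monomials `∏_{i ∈ e} λ_i^{α_i}` with `∑_{i ∈ e} α_i = j`.
There is no such monomial, and the span is `{0}`, for `j < 0`. -/
def PolyExt {d : ℕ} (T : Simp d) (e : Finset (Fin (d + 1))) (j : ℤ) : Submodule ℝ (E d → ℝ) :=
  Submodule.span ℝ {p | ∃ α : Fin (d + 1) → ℕ, ((∑ i ∈ e, α i : ℕ) : ℤ) = j ∧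
    p = fun x => ∏ i ∈ e, (bary T i x) ^ (α i)}

/-- The bubble polynomial `b_e = ∏_{i ∈ e} λ_i`. -/
def bubble {d : ℕ} (T : Simp d) (e : Finset (Fin (d + 1))) (x : E d) : ℝ :=
  ∏ i ∈ e, bary T i x

/-- `P_r Λ^k = P_r ⊗ Alt^k`: differential `k`-forms with polynomial coefficients of degree at most
`r`. A polynomial form on a `d`-simplex is identified with its unique polynomial extension to
`ℝ^d`. -/
def PolyForm (d r k : ℕ) : Submodule ℝ (E d → Alt d k) :=
  Submodule.span ℝ {ω | ∃ p ∈ Poly d r, ∃ η : Alt d k, ω = fun x => p x • η}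

/-! ### The index set of the decomposition -/

/-- The triples `(e, f, σ)` with `e ⊆ f` sub-simplices of dimensions `s` and `ℓ`, where
`max {s, k} ≤ ℓ ≤ min {k + s, d}`, and `σ ∈ Σ(s + k - ℓ, s)` an increasing sequence. The
inequalities `s ≤ ℓ` and `ℓ ≤ d` follow from `e ⊆ f ⊆ {0, …, d}`. -/
structure Index (d k : ℕ) where
  /-- the dimension of `e` -/
  s : ℕ
  /-- the dimension of `f` -/
  l : ℕ
  /-- the smaller sub-simplex -/
  e : Finset (Fin (d + 1))
  /-- the larger sub-simplex -/
  f : Finset (Fin (d + 1))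
  card_e : e.card = s + 1
  card_f : f.card = l + 1
  sub : e ⊆ f
  k_le : k ≤ l
  le_add : l ≤ k + s
  /-- the increasing sequence `σ : {1, …, s + k - ℓ} → {1, …, s}` -/
  σ : Fin (s + k - l) ↪o Fin s

namespace Index

theorem s_le_l {d k : ℕ} (I : Index d k) : I.s ≤ I.l := by
  have h := Finset.card_le_card I.sub
  rw [I.card_e, I.card_f] at h
  omega

theorem card_sdiff {d k : ℕ} (I : Index d k) : (I.f \ I.e).card = I.l - I.s := by
  rw [Finset.card_sdiff_of_subset I.sub, I.card_e, I.card_f]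
  omega

theorem degree_eq {d k : ℕ} (I : Index d k) : k = (I.s + k - I.l) + (I.l - I.s) := by
  have h1 := I.s_le_l
  have h2 := I.le_add
  omega

/-- `[f \ e]`: the elements of `f \ e` in increasing order. -/
def compl {d k : ℕ} (I : Index d k) : Fin (I.l - I.s) ↪o Fin (d + 1) :=
  (I.f \ I.e).orderEmbOfFin I.card_sdiff

end Index

/-- A choice of a basis `t^e_1, …, t^e_s` of the tangent plane `𝒯^e` of every sub-simplex `e`
(of dimension `s`). -/
abbrev TangentBases {d : ℕ} (T : Simp d) : Type :=
  ∀ (s : ℕ) (e : Finset (Fin (d + 1))), e.card = s + 1 → Module.Basis (Fin s) ℝ (tangent T e)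

/-- The covectors `d♭ t^e_{σ(1)}, …, d♭ t^e_{σ(s+k-ℓ)}`. -/
def tCovectors {d k : ℕ} {T : Simp d} (t : TangentBases T) (I : Index d k) :
    Fin (I.s + k - I.l) → Module.Dual ℝ (E d) :=
  fun m => flat (t I.s I.e I.card_e (I.σ m) : E d)

/-- The `k`-form `d♭ t^e_σ ∧ dλ_{[f \ e]}`. -/
def basisForm {d k : ℕ} {T : Simp d} (t : TangentBases T) (I : Index d k) : Alt d k :=
  wedge (Fin.append (tCovectors t I) (fun m => dBary T (I.compl m)) ∘ Fin.cast I.degree_eq)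

/-- The `k`-form `d♭ t^e_σ ∧ d_f λ̂_{[f \ e]}`, where `d_f λ̂_{[f \ e]}` is the wedge product of the
covectors `d_{e ∪ {i}} λ_i` over the elements `i` of `f \ e` in increasing order. -/
def dualForm {d k : ℕ} {T : Simp d} (t : TangentBases T) (I : Index d k) : Alt d k :=
  wedge (Fin.append (tCovectors t I) (fun m => dFaceBary T (insert (I.compl m) I.e) (I.compl m)) ∘
    Fin.cast I.degree_eq)

/-- The linear map `p ↦ b_e p η` from functions to `k`-forms. -/
def bubbleMul {d k : ℕ} (T : Simp d) (e : Finset (Fin (d + 1))) (η : Alt d k) :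
    (E d → ℝ) →ₗ[ℝ] (E d → Alt d k) where
  toFun p := fun x => (bubble T e x * p x) • η
  map_add' p q := by
    funext x
    simp [mul_add, add_smul]
  map_smul' c p := by
    funext x
    simp [smul_smul, mul_left_comm]

/-- The subspace `b_e P_{r-(s+1)}(e) d♭ t^e_σ ∧ dλ_{[f \ e]}` of the space of `k`-forms. -/
def piece {d k : ℕ} {T : Simp d} (t : TangentBases T) (r : ℕ) (I : Index d k) :
    Submodule ℝ (E d → Alt d k) :=
  (PolyExt T I.e ((r : ℤ) - (I.s + 1))).map (bubbleMul T I.e (basisForm t I))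

/-- The degree of freedom `∫_e ⟨ω, d♭ t^e_σ ∧ d_f λ̂_{[f \ e]}⟩ q ds`. Here `ds` is the
`s`-dimensional Euclidean surface measure on the `s`-dimensional simplex `e`; for `s = 0` it is the
unit mass at the vertex. -/
def dof {d k : ℕ} {T : Simp d} (t : TangentBases T) (I : Index d k) (ω : E d → Alt d k)
    (q : geom T I.e → ℝ) : ℝ :=
  ∫ x : geom T I.e, altInner (ω x) (dualForm t I) * q x ∂μHE[I.s]

end

end GeoDec

/-! Fix a sub-simplex `e` of dimension `s`. The covectors `d♭ t^e_n` together with the `dλ_j`, `j ∉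
e`, form a basis of the dual of `ℝ^d`, and so do the `d♭ t^e_n` with the `d_{e ∪ {j}} λ_j`. The
pairs `(f, σ)` correspond to the `k`-element subsets of this basis, so the forms `basisForm`, and
likewise `dualForm`, attached to `e` are a basis of `Alt^k` (`exists_eq_sum_basisForm`,
`eq_zero_of_sum_basisForm`, `exists_eq_sum_dualForm`). Spanning then reduces to scalars: a Bernstein
monomial with support `e` is `b_e` times a monomial on `e` (`polyForm_le_iSup_piece`).

Directness and unisolvence both follow from `eq_zero_of_dofMap_assemble`: if all degrees of freedom
of `∑ b_e p_I basisForm I` vanish, then every `p_I` does. By induction on the number of vertices,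
the terms of proper faces of `e` are zero; the terms of sub-simplices not contained in `e` vanish on
`e` through their bubbles. Hence on `e` only `b_e ∑ p_I basisForm I` over the indices of `e`
remains. The dual forms span, so each component `c` of that sum satisfies `∫_e b_e c q = 0` for all
test functions; `q = c` and positivity of `b_e` give `c = 0`, and independence of the basis forms
gives `p_I = 0`. Arbitrary prescription of the degrees of freedom follows by counting dimensions. -/

namespace GeoDec

noncomputable section

/-! ### Bases of `Alt^k` made of wedges of coordinate covectors -/

section WedgeBasis

variable {d k : ℕ} {ι : Type*}

theorem wedge_apply (φ : Fin k → Module.Dual ℝ (E d)) (v : Fin k → E d) :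
    wedge φ v = (Matrix.of fun i j => φ j (v i)).det := rfl

/-- Covectors that are jointly injective and as many as the dimension are the coordinates of a
basis. -/
theorem exists_basis_coord [Fintype ι] (φ : ι → Module.Dual ℝ (E d))
    (hcard : Fintype.card ι = d) (hφ : ∀ v, (∀ i, φ i v = 0) → v = 0) :
    ∃ u : Module.Basis ι ℝ (E d), ∀ i, u.coord i = φ i := by
  have hinj : Function.Injective (LinearMap.pi φ) := by
    rw [← LinearMap.ker_eq_bot, LinearMap.ker_eq_bot']
    intro v hv
    exact hφ v fun i => congrFun hv i
  have hfr : Module.finrank ℝ (E d) = Module.finrank ℝ (ι → ℝ) := by simp [hcard]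
  refine ⟨Module.Basis.ofEquivFun (LinearEquiv.ofInjectiveOfFinrankEq (LinearMap.pi φ) hinj hfr),
    fun i => ?_⟩
  ext v
  rw [Module.Basis.coord_apply, Module.Basis.ofEquivFun_repr_apply]
  rfl

variable (u : Module.Basis ι ℝ (E d))

theorem wedge_coord_self {g : Fin k → ι} (hg : Function.Injective g) :
    wedge (fun i => u.coord (g i)) (fun i => u (g i)) = 1 := by
  classical
  rw [wedge_apply]
  convert Matrix.det_one (n := Fin k) (R := ℝ)
  ext i j
  simp [Finsupp.single_apply, hg.eq_iff, Matrix.one_apply]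

theorem wedge_coord_of_notMem {g h : Fin k → ι} {j : Fin k} (hj : g j ∉ Set.range h) :
    wedge (fun i => u.coord (g i)) (fun i => u (h i)) = 0 := by
  classical
  rw [wedge_apply]
  refine Matrix.det_eq_zero_of_column_eq_zero j fun i => ?_
  have : h i ≠ g j := fun hi => hj ⟨i, hi⟩
  simp [Finsupp.single_apply, this]

theorem sum_smul_apply {A : Type*} [Fintype A] (c : A → ℝ) (η : A → Alt d k) (v : Fin k → E d) :
    (∑ a, c a • η a) v = ∑ a, c a * η a v :=
  map_sum ({ toFun := fun ω => ω v, map_zero' := rfl, map_add' := fun _ _ => rfl } :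
    Alt d k →+ ℝ) _ _

/-- A family of injective `k`-tuples in `ι` that lists every `k`-element subset exactly once. -/
structure ListsSubsets {A : Type*} (g : A → Fin k → ι) : Prop where
  inj : ∀ a, Function.Injective (g a)
  unique : ∀ a b, Set.range (g a) = Set.range (g b) → a = b
  exists_range : ∀ v : Fin k → ι, Function.Injective v → ∃ a, Set.range v = Set.range (g a)

variable {A : Type*} {g : A → Fin k → ι}

/-- Two different subsets of equal size differ by an element of the first outside the second, which
makes a column of the determinant zero; for equal indices the matrix is the identity. -/
theorem ListsSubsets.wedge_coord [DecidableEq A] (hg : ListsSubsets g) (a b : A) :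
    wedge (fun i => u.coord (g a i)) (fun i => u (g b i)) = if a = b then 1 else 0 := by
  split_ifs with hab
  · subst hab
    exact wedge_coord_self u (hg.inj a)
  · by_cases h : Set.range (g a) ⊆ Set.range (g b)
    · refine absurd (hg.unique a b (Set.eq_of_subset_of_ncard_le h ?_ (Set.finite_range _))) hab
      rw [← Set.image_univ, ← Set.image_univ, Set.ncard_image_of_injective _ (hg.inj a),
        Set.ncard_image_of_injective _ (hg.inj b)]
    · obtain ⟨x, ⟨j, rfl⟩, hj⟩ := Set.not_subset.1 h
      exact wedge_coord_of_notMem u hj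

/-- An alternating map is determined by injective tuples of basis vectors. Each is a permutation of
a listed tuple, and both sides change by the same sign. -/
theorem ListsSubsets.eq_sum [Fintype A] (hg : ListsSubsets g) (η : Alt d k) :
    η = ∑ a, η (fun i => u (g a i)) • wedge (fun i => u.coord (g a i)) := by
  classical
  refine Module.Basis.ext_alternating u fun v hv => ?_
  obtain ⟨b, hb⟩ := hg.exists_range v hv
  have hπ : ∀ i, ∃ j, g b j = v i := fun i => by
    have : v i ∈ Set.range (g b) := hb ▸ ⟨i, rfl⟩
    exact this
  choose π hπ using hπ
  have hπi : Function.Injective π := fun i j hij => hv (by rw [← hπ, ← hπ, hij])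
  let τ : Equiv.Perm (Fin k) := Equiv.ofBijective π (Finite.injective_iff_bijective.1 hπi)
  have hv' : (fun i => u (v i)) = (fun i => u (g b i)) ∘ τ := by
    funext i
    simp [τ, hπ]
  rw [hv', AlternatingMap.map_perm, AlternatingMap.map_perm]
  congr 1
  rw [sum_smul_apply]
  simp [hg.wedge_coord u]

theorem ListsSubsets.eq_zero [Fintype A] (hg : ListsSubsets g) (c : A → ℝ)
    (hc : ∑ a, c a • wedge (fun i => u.coord (g a i)) = 0) (b : A) : c b = 0 := by
  classical
  have := congrArg (fun η : Alt d k => η (fun i => u (g b i))) hc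
  simpa [sum_smul_apply, hg.wedge_coord u] using this

end WedgeBasis

/-! ### Combinatorics of the index set -/

namespace Index

variable {d k : ℕ}

/-- The values of `σ` are compared in `ℕ` because the two sequences have different types until the
dimensions are identified. -/
theorem ext_of_range {I J : Index d k} (he : I.e = J.e) (hf : I.f = J.f)
    (hσ : ∀ n : ℕ, (∃ i, (I.σ i : ℕ) = n) ↔ ∃ j, (J.σ j : ℕ) = n) : I = J := by
  obtain ⟨s, l, e, f, ce, cf, sub, h1, h2, σ⟩ := I
  obtain ⟨s', l', e', f', ce', cf', sub', h1', h2', σ'⟩ := J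
  dsimp only at he hf hσ
  subst he hf
  obtain rfl : s = s' := by omega
  obtain rfl : l = l' := by omega
  have : σ = σ' := by
    rw [← OrderEmbedding.range_inj]
    ext x
    have := hσ x
    simpa [Fin.ext_iff] using this
  subst this
  rfl

theorem s_eq {I : Index d k} {s : ℕ} {e : Finset (Fin (d + 1))} (he : e.card = s + 1)
    (h : I.e = e) : I.s = s := by
  have := I.card_e
  rw [h] at this
  omega

theorem compl_mem (I : Index d k) (m : Fin (I.l - I.s)) : I.compl m ∈ I.f \ I.e :=
  Finset.orderEmbOfFin_mem _ _ _

theorem range_compl (I : Index d k) : Set.range I.compl = ((I.f \ I.e : Finset _) : Set _) :=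
  Finset.range_orderEmbOfFin _ _

variable {s : ℕ} {e : Finset (Fin (d + 1))}

/-- For the indices with first sub-simplex `e`, the pair `(σ, f)` as a `k`-tuple of elements of
`{1, …, s} ⊔ eᶜ`. -/
def tuple (he : e.card = s + 1) (I : {I : Index d k // I.e = e}) :
    Fin k → Fin s ⊕ {j : Fin (d + 1) // j ∉ e} :=
  Fin.append (fun m => Sum.inl (Fin.cast (s_eq he I.2) (I.1.σ m)))
    (fun m => Sum.inr ⟨I.1.compl m, by
      have := I.1.compl_mem m
      rw [I.2] at this
      exact (Finset.mem_sdiff.1 this).2⟩) ∘ Fin.cast I.1.degree_eq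

theorem mem_range_tuple (he : e.card = s + 1) (I : {I : Index d k // I.e = e})
    (x : Fin s ⊕ {j : Fin (d + 1) // j ∉ e}) :
    x ∈ Set.range (tuple he I) ↔
      x.elim (fun n : Fin s => ∃ i, (I.1.σ i : ℕ) = n) (fun j => j.1 ∈ I.1.f) := by
  have hsurj : Set.range (tuple he I) = Set.range (Fin.append
      (fun m => Sum.inl (Fin.cast (s_eq he I.2) (I.1.σ m)))
      (fun m => (Sum.inr ⟨I.1.compl m, by
        have := I.1.compl_mem m
        rw [I.2] at this
        exact (Finset.mem_sdiff.1 this).2⟩ : Fin s ⊕ {j : Fin (d + 1) // j ∉ e}))) :=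
    (finCongr I.1.degree_eq).surjective.range_comp _
  rw [hsurj]
  constructor
  · rintro ⟨i, rfl⟩
    induction i using Fin.addCases with
    | left i => simp
    | right i =>
      have := I.1.compl_mem i
      simpa using (Finset.mem_sdiff.1 this).1
  · rcases x with n | ⟨j, hj⟩
    · rintro ⟨i, hi⟩
      refine ⟨Fin.castAdd _ i, ?_⟩
      simp [Fin.ext_iff, hi]
    · intro hjf
      have : j ∈ Set.range I.1.compl := by
        rw [range_compl, I.2]
        simpa [hj] using hjf
      obtain ⟨i, hi⟩ := this
      exact ⟨Fin.natAdd _ i, by simp [hi]⟩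

theorem tuple_injective (he : e.card = s + 1) (I : {I : Index d k // I.e = e}) :
    Function.Injective (tuple he I) := by
  refine Function.Injective.comp ?_ (finCongr I.1.degree_eq).injective
  rw [Fin.append_injective_iff]
  refine ⟨fun i j h => ?_, fun i j h => ?_, fun i j => by simp⟩
  · simpa using h
  · simpa using h

/-- A subset of `{1, …, s} ⊔ eᶜ` splits into the range of `σ` and `f \ e`. The bounds `k ≤ ℓ ≤ k +
s` say exactly that the left part has at most `s` elements and the right part at most `k`. -/
theorem listsSubsets_tuple (he : e.card = s + 1) :
    ListsSubsets (k := k) (tuple (d := d) he) where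
  inj := tuple_injective he
  unique I J h := by
    have h' : ∀ x, _ := fun x => (mem_range_tuple he I x).symm.trans
      ((Set.ext_iff.1 h x).trans (mem_range_tuple he J x))
    refine Subtype.ext (ext_of_range (I.2.trans J.2.symm) ?_ fun n => ?_)
    · ext j
      by_cases hj : j ∈ e
      · exact iff_of_true (I.1.sub (I.2.symm ▸ hj)) (J.1.sub (J.2.symm ▸ hj))
      · exact h' (Sum.inr ⟨j, hj⟩)
    · by_cases hn : n < s
      · exact h' (Sum.inl ⟨n, hn⟩)
      · refine iff_of_false ?_ ?_
        · rintro ⟨i, rfl⟩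
          exact hn ((I.1.σ i).2.trans_eq (s_eq he I.2))
        · rintro ⟨i, rfl⟩
          exact hn ((J.1.σ i).2.trans_eq (s_eq he J.2))
  exists_range v hv := by
    classical
    let S := Finset.univ.image v
    have hS : S.card = k := by
      rw [Finset.card_image_of_injective _ hv, Finset.card_fin]
    have hsum := S.card_toLeft_add_card_toRight
    have hle : S.toLeft.card ≤ s := (Finset.card_le_univ _).trans_eq (Fintype.card_fin s)
    let R : Finset (Fin (d + 1)) := S.toRight.map (Function.Embedding.subtype _)
    have hR : Disjoint e R := by
      rw [Finset.disjoint_right]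
      intro j hj
      simp only [R, Finset.mem_map] at hj
      obtain ⟨j', _, rfl⟩ := hj
      exact j'.2
    have hRc : R.card = S.toRight.card := Finset.card_map _
    refine ⟨⟨{ s := s, l := s + S.toRight.card, e := e, f := e ∪ R, card_e := he,
               card_f := by rw [Finset.card_union_of_disjoint hR, he, hRc]; omega,
               sub := Finset.subset_union_left, k_le := by omega, le_add := by omega,
               σ := S.toLeft.orderEmbOfFin (by omega) }, rfl⟩, ?_⟩
    ext x
    rw [mem_range_tuple]
    have hx : x ∈ Set.range v ↔ x ∈ S := by simp [S]
    rw [hx]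
    rcases x with n | ⟨j, hj⟩
    · have := Set.ext_iff.1 (Finset.range_orderEmbOfFin S.toLeft
        (k := s + k - (s + S.toRight.card)) (by omega)) n
      simp only [Set.mem_range, Finset.mem_coe, Finset.mem_toLeft] at this
      simp [← this, Fin.ext_iff]
    · simp [R, hj]

/-- An index is recovered from `e`, `f` and the range of `σ`, viewed inside the fixed type `Fin (d +
1)`. -/
instance : Finite (Index d k) := by
  have : Function.Injective (fun I : Index d k =>
      (I.e, I.f, (Finset.univ.image fun i => Fin.castLE (show I.s ≤ d + 1 by
        have := I.card_e
        have := Finset.card_le_univ I.e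
        rw [Fintype.card_fin] at this
        omega) (I.σ i)))) := by
    intro I J h
    simp only [Prod.mk.injEq] at h
    refine ext_of_range h.1 h.2.1 fun n => ?_
    by_cases hn : n < d + 1
    · simpa [Fin.ext_iff] using Finset.ext_iff.1 h.2.2 ⟨n, hn⟩
    · have key : ∀ K : Index d k, ¬ ∃ i, (K.σ i : ℕ) = n := by
        rintro K ⟨i, rfl⟩
        have h1 := K.card_e
        have h2 := Finset.card_le_univ K.e
        rw [Fintype.card_fin] at h2
        have := (K.σ i).2
        omega
      exact iff_of_false (key I) (key J)
  exact Finite.of_injective _ this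

end Index

end

end GeoDec

namespace GeoDec

noncomputable section

variable {d k : ℕ}

/-! ### Barycentric coordinates and tangent planes -/

section Barycentric

variable (T : Simp d)

theorem bary_point (i j : Fin (d + 1)) : bary T i (T.points j) = if i = j then 1 else 0 :=
  (affBasis T).coord_apply i j

theorem sum_bary (x : E d) : ∑ i, bary T i x = 1 :=
  (affBasis T).sum_coord_apply_eq_one x

theorem sum_bary_smul (x : E d) : ∑ i, bary T i x • T.points i = x :=
  (affBasis T).linear_combination_coord_eq_self x

theorem dBary_apply (i : Fin (d + 1)) (v : E d) : dBary T i v = bary T i v - bary T i 0 := by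
  have := congrFun (AffineMap.decomp' (bary T i)) v
  simpa [dBary] using this

theorem dBary_sub (i : Fin (d + 1)) (x y : E d) : dBary T i (x - y) = bary T i x - bary T i y := by
  rw [map_sub, dBary_apply, dBary_apply]
  ring

/-- The `λ_i` sum to one, so their differentials sum to zero and the base point `p` drops out. -/
theorem sum_dBary_smul_sub (v p : E d) : ∑ i, dBary T i v • (T.points i - p) = v := by
  have h0 : ∑ i, dBary T i v = 0 := by
    simp [dBary_apply, Finset.sum_sub_distrib, sum_bary]
  rw [Finset.sum_congr rfl fun i _ => smul_sub _ _ _, Finset.sum_sub_distrib, ← Finset.sum_smul, h0,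
    zero_smul, sub_zero, Finset.sum_congr rfl fun i _ => by rw [dBary_apply, sub_smul],
    Finset.sum_sub_distrib, sum_bary_smul, sum_bary_smul, sub_zero]

theorem continuous_bary (i : Fin (d + 1)) : Continuous (bary T i) :=
  continuous_barycentric_coord (affBasis T) i

variable {T} {e : Finset (Fin (d + 1))}

theorem sub_mem_tangent {i j : Fin (d + 1)} (hi : i ∈ e) (hj : j ∈ e) :
    T.points i - T.points j ∈ tangent T e :=
  vsub_mem_vectorSpan ℝ (Set.mem_image_of_mem _ hi) (Set.mem_image_of_mem _ hj)

theorem dBary_eq_zero_of_mem_tangent {v : E d} (hv : v ∈ tangent T e) {j : Fin (d + 1)}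
    (hj : j ∉ e) : dBary T j v = 0 := by
  have : tangent T e ≤ LinearMap.ker (dBary T j) := by
    rw [tangent, vectorSpan_def, Submodule.span_le]
    rintro _ ⟨_, ⟨a, ha, rfl⟩, _, ⟨b, hb, rfl⟩, rfl⟩
    have h1 : j ≠ a := fun h => hj (h ▸ ha)
    have h2 : j ≠ b := fun h => hj (h ▸ hb)
    simp [dBary_sub, bary_point, h1, h2]
  exact this hv

theorem mem_tangent_iff (he : e.Nonempty) {v : E d} :
    v ∈ tangent T e ↔ ∀ j ∉ e, dBary T j v = 0 := by
  refine ⟨fun hv j hj => dBary_eq_zero_of_mem_tangent hv hj, fun h => ?_⟩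
  obtain ⟨i, hi⟩ := he
  rw [← sum_dBary_smul_sub T v (T.points i)]
  refine Submodule.sum_mem _ fun j _ => ?_
  by_cases hj : j ∈ e
  · exact Submodule.smul_mem _ _ (sub_mem_tangent hj hi)
  · rw [h j hj, zero_smul]
    exact Submodule.zero_mem _

end Barycentric

/-! ### The covector bases attached to a sub-simplex -/

section Covectors

variable {T : Simp d} (t : TangentBases T) {s : ℕ} {e : Finset (Fin (d + 1))}

/-- The covectors `d♭ t^e_1, …, d♭ t^e_s`, followed by covectors `θ_j` for the vertices `j` outside
of `e`. -/
def covectors (he : e.card = s + 1) (θ : Fin (d + 1) → Module.Dual ℝ (E d)) :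
    Fin s ⊕ {j : Fin (d + 1) // j ∉ e} → Module.Dual ℝ (E d) :=
  Sum.elim (fun n => flat (t s e he n : E d)) (fun j => θ j)

theorem card_index_covectors (he : e.card = s + 1) :
    Fintype.card (Fin s ⊕ {j : Fin (d + 1) // j ∉ e}) = d := by
  have h := Fintype.card_subtype_compl (fun j : Fin (d + 1) => j ∈ e)
  rw [Fintype.card_fin, Fintype.card_coe, he] at h
  have := Finset.card_le_univ e
  rw [Fintype.card_fin] at this
  rw [Fintype.card_sum, h, Fintype.card_fin]
  omega

theorem mem_orthogonal_of_flat_eq_zero (he : e.card = s + 1) {v : E d}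
    (h : ∀ n, flat (t s e he n : E d) v = 0) : v ∈ (tangent T e)ᗮ := by
  intro w hw
  have : (⟨w, hw⟩ : tangent T e) ∈ Submodule.span ℝ (Set.range (t s e he)) := by
    rw [(t s e he).span_eq]
    trivial
  have hle : Submodule.span ℝ (Set.range (t s e he)) ≤
      LinearMap.ker ((innerSL ℝ v : E d →ₗ[ℝ] ℝ) ∘ₗ (tangent T e).subtype) := by
    rw [Submodule.span_le]
    rintro _ ⟨n, rfl⟩
    have := h n
    simpa [flat, real_inner_comm] using this
  have := hle this
  simpa [real_inner_comm] using this

/-- The first covectors force `v` to be orthogonal to `𝒯^e`, while the `dλ_j` with `j ∉ e` cut out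
`𝒯^e` itself. -/
theorem eq_zero_of_covectors_dBary (he : e.card = s + 1) {v : E d}
    (h : ∀ i, covectors t he (dBary T) i v = 0) : v = 0 := by
  have h1 := mem_orthogonal_of_flat_eq_zero t he fun n => h (Sum.inl n)
  have h2 : v ∈ tangent T e :=
    (mem_tangent_iff (Finset.card_pos.1 (by omega))).2 fun j hj => h (Sum.inr ⟨j, hj⟩)
  exact inner_self_eq_zero.1 (h1 v h2)

/-- The conditions make `v` orthogonal to every `𝒯^{e ∪ {j}}`, and these planes together contain all
differences of vertices from a vertex of `e`, which span `ℝ^d`. -/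
theorem eq_zero_of_covectors_dFaceBary (he : e.card = s + 1) {v : E d}
    (h : ∀ i, covectors t he (fun j => dFaceBary T (insert j e) j) i v = 0) : v = 0 := by
  have h1 := mem_orthogonal_of_flat_eq_zero t he fun n => h (Sum.inl n)
  have hne : e.Nonempty := Finset.card_pos.1 (by omega)
  have hmono : ∀ j, tangent T e ≤ tangent T (insert j e) := fun j =>
    vectorSpan_mono ℝ (Set.image_mono (by simp))
  have h2 : ∀ j ∉ e, v ∈ (tangent T (insert j e))ᗮ := by
    intro j hj
    rw [← Submodule.starProjection_apply_eq_zero_iff]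
    set w := (tangent T (insert j e)).starProjection v with hw
    have hwe : w ∈ tangent T e := by
      refine (mem_tangent_iff hne).2 fun i hi => ?_
      by_cases hij : i = j
      · subst hij
        exact h (Sum.inr ⟨i, hi⟩)
      · exact dBary_eq_zero_of_mem_tangent (Submodule.starProjection_apply_mem _ _)
          (by simp [hij, hi])
    -- Since `w` lies in `𝒯^e`, both `⟨v - w, w⟩` and `⟨v, w⟩` vanish, hence `⟨w, w⟩ = 0`.
    have h3 := Submodule.starProjection_inner_eq_zero (K := tangent T (insert j e)) v w
      (hmono j hwe)
    rw [inner_sub_left, real_inner_comm, h1 w hwe, zero_sub, neg_eq_zero] at h3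
    exact inner_self_eq_zero.1 h3
  obtain ⟨i, hi⟩ := hne
  have h3 : ∀ j, inner ℝ (T.points j - T.points i) v = 0 := by
    intro j
    by_cases hj : j ∈ e
    · exact h1 _ (sub_mem_tangent hj hi)
    · exact h2 j hj _ (sub_mem_tangent (Finset.mem_insert_self _ _) (Finset.mem_insert_of_mem hi))
  rw [← inner_self_eq_zero (𝕜 := ℝ)]
  nth_rewrite 1 [← sum_dBary_smul_sub T v (T.points i)]
  simp [sum_inner, inner_smul_left, h3]

/-- Brings both form families, through the choice of `θ`, into the shape required by `ListsSubsets`.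
-/
theorem wedge_append_eq (he : e.card = s + 1) (I : {I : Index d k // I.e = e})
    (θ : Fin (d + 1) → Module.Dual ℝ (E d)) :
    wedge (Fin.append (tCovectors t I.1) (fun m => θ (I.1.compl m)) ∘ Fin.cast I.1.degree_eq) =
      wedge (fun i => covectors t he θ (Index.tuple he I i)) := by
  obtain ⟨I, rfl⟩ := I
  obtain rfl : s = I.s := by
    have := I.card_e
    omega
  congr 1
  funext i
  simp only [Index.tuple, Function.comp_apply]
  generalize Fin.cast I.degree_eq i = i'
  induction i' using Fin.addCases with
  | left i => simp [covectors, tCovectors]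
  | right i => simp [covectors]

variable [Fintype {I : Index d k // I.e = e}]

theorem exists_eq_sum_basisForm (he : e.card = s + 1) (η : Alt d k) :
    ∃ c : {I : Index d k // I.e = e} → ℝ, η = ∑ I, c I • basisForm t I.1 := by
  obtain ⟨u, hu⟩ := exists_basis_coord (covectors t he (dBary T)) (card_index_covectors he)
    fun v => eq_zero_of_covectors_dBary t he
  refine ⟨fun I => η fun i => u (Index.tuple he I i),
    ((Index.listsSubsets_tuple he).eq_sum u η).trans (Finset.sum_congr rfl fun I _ => ?_)⟩
  congr 1
  rw [basisForm, wedge_append_eq t he]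
  simp only [hu]

theorem eq_zero_of_sum_basisForm (he : e.card = s + 1) (c : {I : Index d k // I.e = e} → ℝ)
    (hc : ∑ I, c I • basisForm t I.1 = 0) (I : {I : Index d k // I.e = e}) : c I = 0 := by
  obtain ⟨u, hu⟩ := exists_basis_coord (covectors t he (dBary T)) (card_index_covectors he)
    fun v => eq_zero_of_covectors_dBary t he
  refine (Index.listsSubsets_tuple he).eq_zero u c (Eq.trans ?_ hc) I
  refine Finset.sum_congr rfl fun I _ => ?_
  rw [basisForm, wedge_append_eq t he]
  simp only [hu]

theorem exists_eq_sum_dualForm (he : e.card = s + 1) (η : Alt d k) :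
    ∃ c : {I : Index d k // I.e = e} → ℝ, η = ∑ I, c I • dualForm t I.1 := by
  obtain ⟨u, hu⟩ := exists_basis_coord (covectors t he fun j => dFaceBary T (insert j e) j)
    (card_index_covectors he) fun v => eq_zero_of_covectors_dFaceBary t he
  refine ⟨fun I => η fun i => u (Index.tuple he I i),
    ((Index.listsSubsets_tuple he).eq_sum u η).trans (Finset.sum_congr rfl fun I _ => ?_)⟩
  congr 1
  have h := wedge_append_eq t he I fun j => dFaceBary T (insert j e) j
  simp only [hu]
  rw [← h, dualForm]
  obtain ⟨I, rfl⟩ := I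
  rfl

end Covectors

/-! ### The inner product on alternating forms -/

section AltInner

theorem listsSubsets_orderEmbedding :
    ListsSubsets (fun σ : Fin k ↪o Fin d => (σ : Fin k → Fin d)) where
  inj σ := σ.injective
  unique σ τ h := OrderEmbedding.range_inj.1 h
  exists_range v hv := by
    refine ⟨(Finset.univ.image v).orderEmbOfFin (by
      rw [Finset.card_image_of_injective _ hv, Finset.card_fin]), ?_⟩
    rw [Finset.range_orderEmbOfFin]
    simp

/-- The tuple `e_{σ(1)}, …, e_{σ(k)}` of standard basis vectors. -/
def stdTuple (σ : Fin k ↪o Fin d) : Fin k → E d :=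
  fun i => EuclideanSpace.basisFun (Fin d) ℝ (σ i)

/-- The element of the basis of `Alt^k` that is dual to the tuple `stdTuple σ`. -/
def stdForm (σ : Fin k ↪o Fin d) : Alt d k :=
  wedge fun i => (EuclideanSpace.basisFun (Fin d) ℝ).toBasis.coord (σ i)

/-- Pairing with `stdForm σ` extracts a component, so moments against constant forms control each
scalar coefficient. -/
theorem altInner_stdForm (ω : Alt d k) (σ : Fin k ↪o Fin d) :
    altInner ω (stdForm σ) = ω (stdTuple σ) := by
  have h := listsSubsets_orderEmbedding.wedge_coord (EuclideanSpace.basisFun (Fin d) ℝ).toBasis σ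
  simp only [OrthonormalBasis.coe_toBasis] at h
  simp only [altInner, stdForm, h, mul_ite, mul_one, mul_zero, Finset.sum_ite_eq,
    Finset.mem_univ, if_true]
  rfl

theorem ext_stdTuple {ω η : Alt d k} (h : ∀ σ, ω (stdTuple σ) = η (stdTuple σ)) : ω = η := by
  rw [listsSubsets_orderEmbedding.eq_sum (EuclideanSpace.basisFun (Fin d) ℝ).toBasis ω,
    listsSubsets_orderEmbedding.eq_sum (EuclideanSpace.basisFun (Fin d) ℝ).toBasis η]
  refine Finset.sum_congr rfl fun σ _ => ?_
  congr 1
  simp only [OrthonormalBasis.coe_toBasis]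
  exact h σ

theorem altInner_sum_right {A : Type*} [Fintype A] (ω : Alt d k) (c : A → ℝ) (η : A → Alt d k) :
    altInner ω (∑ a, c a • η a) = ∑ a, c a * altInner ω (η a) := by
  simp only [altInner, sum_smul_apply, Finset.mul_sum]
  rw [Finset.sum_comm]
  refine Finset.sum_congr rfl fun a _ => Finset.sum_congr rfl fun σ _ => ?_
  ring

theorem altInner_smul_left (c : ℝ) (ω η : Alt d k) :
    altInner (c • ω) η = c * altInner ω η := by
  simp [altInner, Finset.mul_sum, mul_assoc]

theorem altInner_add_left (ω ω' η : Alt d k) :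
    altInner (ω + ω') η = altInner ω η + altInner ω' η := by
  simp [altInner, Finset.sum_add_distrib, add_mul]

end AltInner

end

end GeoDec

namespace GeoDec

noncomputable section

variable {d : ℕ}

/-! ### Polynomial functions on `ℝ^d` -/

section Poly

theorem mem_poly_iff {n : ℕ} {f : E d → ℝ} :
    f ∈ Poly d n ↔ ∃ P : MvPolynomial (Fin d) ℝ, P.totalDegree ≤ n ∧ evalPoly d P = f := by
  simp [Poly, MvPolynomial.mem_restrictTotalDegree]

theorem evalPoly_apply (P : MvPolynomial (Fin d) ℝ) (x : E d) :
    evalPoly d P x = MvPolynomial.aeval (fun i => x i) P := rfl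

theorem evalPoly_mul (P Q : MvPolynomial (Fin d) ℝ) :
    evalPoly d (P * Q) = evalPoly d P * evalPoly d Q := by
  funext x
  simp [evalPoly_apply]

theorem mul_mem_poly {m n : ℕ} {f g : E d → ℝ} (hf : f ∈ Poly d m) (hg : g ∈ Poly d n) :
    f * g ∈ Poly d (m + n : ℕ) := by
  obtain ⟨P, hP, rfl⟩ := mem_poly_iff.1 hf
  obtain ⟨Q, hQ, rfl⟩ := mem_poly_iff.1 hg
  exact mem_poly_iff.2 ⟨P * Q, (MvPolynomial.totalDegree_mul _ _).trans (by omega),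
    evalPoly_mul P Q⟩

theorem one_mem_poly_zero : (1 : E d → ℝ) ∈ Poly d (0 : ℕ) :=
  mem_poly_iff.2 ⟨1, by simp, by funext x; simp [evalPoly_apply]⟩

theorem pow_mem_poly {f : E d → ℝ} (hf : f ∈ Poly d (1 : ℕ)) (n : ℕ) : f ^ n ∈ Poly d n := by
  induction n with
  | zero => simpa using one_mem_poly_zero
  | succ n ih => simpa [pow_succ] using mul_mem_poly ih hf

theorem prod_mem_poly {ι : Type*} (S : Finset ι) (f : ι → E d → ℝ) (n : ι → ℕ)
    (hf : ∀ i ∈ S, f i ∈ Poly d (n i)) : ∏ i ∈ S, f i ∈ Poly d (∑ i ∈ S, n i : ℕ) := by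
  classical
  induction S using Finset.induction_on with
  | empty => simpa using one_mem_poly_zero
  | insert a S ha ih =>
    rw [Finset.prod_insert ha, Finset.sum_insert ha]
    exact mul_mem_poly (hf a (by simp)) (ih fun i hi => hf i (by simp [hi]))

theorem bary_mem_poly (T : Simp d) (i : Fin (d + 1)) : (bary T i : E d → ℝ) ∈ Poly d (1 : ℕ) := by
  refine mem_poly_iff.2 ⟨MvPolynomial.C (bary T i 0) +
    ∑ j, dBary T i (EuclideanSpace.single j 1) • MvPolynomial.X j, ?_, ?_⟩
  · refine (MvPolynomial.totalDegree_add _ _).trans (max_le (by simp) ?_)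
    refine MvPolynomial.totalDegree_finsetSum_le fun j _ => ?_
    exact (MvPolynomial.totalDegree_smul_le _ _).trans (by simp)
  · funext x
    have hx : x = ∑ j, x j • EuclideanSpace.single j (1 : ℝ) := by
      simpa using ((EuclideanSpace.basisFun (Fin d) ℝ).sum_repr x).symm
    have h1 : bary T i x = bary T i 0 + dBary T i x := by
      rw [dBary_apply]
      ring
    have h2 : dBary T i x = ∑ j, x j * dBary T i (EuclideanSpace.single j 1) := by
      conv_lhs => rw [hx]
      simp
    rw [h1, h2, evalPoly_apply]
    simp [mul_comm]

theorem continuous_of_mem_poly {j : ℤ} {f : E d → ℝ} (hf : f ∈ Poly d j) : Continuous f := by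
  by_cases hj : 0 ≤ j
  · lift j to ℕ using hj
    obtain ⟨P, -, rfl⟩ := mem_poly_iff.1 hf
    have : evalPoly d P = fun x => MvPolynomial.eval (fun i => x i) P := by
      funext x
      rw [evalPoly_apply, MvPolynomial.aeval_eq_eval]
    rw [this]
    exact (MvPolynomial.continuous_eval P).comp (by fun_prop)
  · rw [Poly, if_neg hj, Submodule.mem_bot] at hf
    rw [hf]
    exact continuous_const

end Poly

/-! ### Bernstein forms and restriction to sub-simplices -/

section Bernstein

variable {T : Simp d} {e : Finset (Fin (d + 1))}

theorem monomial_mem_polyExt (α : Fin (d + 1) → ℕ) {j : ℤ} (h : ((∑ i ∈ e, α i : ℕ) : ℤ) = j) :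
    (fun x => ∏ i ∈ e, (bary T i x) ^ (α i)) ∈ PolyExt T e j :=
  Submodule.subset_span ⟨α, h, rfl⟩

theorem mul_mem_polyExt {a b : ℤ} {p q : E d → ℝ} (hp : p ∈ PolyExt T e a)
    (hq : q ∈ PolyExt T e b) : p * q ∈ PolyExt T e (a + b) := by
  have h : PolyExt T e a * PolyExt T e b ≤ PolyExt T e (a + b) := by
    rw [PolyExt, PolyExt, Submodule.span_mul_span, Submodule.span_le]
    rintro _ ⟨_, ⟨α, hα, rfl⟩, _, ⟨β, hβ, rfl⟩, rfl⟩
    rw [SetLike.mem_coe]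
    convert monomial_mem_polyExt (T := T) (e := e) (fun i => α i + β i) (j := a + b) ?_ using 1
    · funext x
      simp [pow_add, Finset.prod_mul_distrib]
    · rw [Finset.sum_add_distrib, Nat.cast_add, hα, hβ]
  exact h (Submodule.mul_mem_mul hp hq)

theorem one_mem_polyExt_zero : (1 : E d → ℝ) ∈ PolyExt T e 0 := by
  convert monomial_mem_polyExt (T := T) (e := e) (fun _ => 0) (j := 0) (by simp) using 1
  funext x
  simp

theorem pow_mem_polyExt {p : E d → ℝ} (hp : p ∈ PolyExt T e 1) (n : ℕ) :
    p ^ n ∈ PolyExt T e n := by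
  induction n with
  | zero => simpa using one_mem_polyExt_zero
  | succ n ih => simpa [pow_succ] using mul_mem_polyExt ih hp

theorem prod_mem_polyExt {ι : Type*} (S : Finset ι) (f : ι → E d → ℝ) (n : ι → ℕ)
    (hf : ∀ i ∈ S, f i ∈ PolyExt T e (n i)) :
    ∏ i ∈ S, f i ∈ PolyExt T e (∑ i ∈ S, n i : ℕ) := by
  classical
  induction S using Finset.induction_on with
  | empty => simpa using one_mem_polyExt_zero
  | insert a S ha ih =>
    rw [Finset.prod_insert ha, Finset.sum_insert ha, Nat.cast_add]
    exact mul_mem_polyExt (hf a (by simp)) (ih fun i hi => hf i (by simp [hi]))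

theorem bary_mem_polyExt {i : Fin (d + 1)} (hi : i ∈ e) :
    (bary T i : E d → ℝ) ∈ PolyExt T e 1 := by
  classical
  convert monomial_mem_polyExt (T := T) (e := e) (fun j => if j = i then 1 else 0) (j := 1)
    (by simp [hi]) using 1
  funext x
  simp [pow_ite, hi]

theorem bubble_mem_polyExt : bubble T e ∈ PolyExt T e e.card := by
  convert monomial_mem_polyExt (T := T) (e := e) (fun _ => 1) (j := e.card) (by simp) using 1
  funext x
  simp [bubble]

theorem polyExt_le_poly (j : ℤ) : PolyExt T e j ≤ Poly d j := by
  rw [PolyExt, Submodule.span_le]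
  rintro _ ⟨α, rfl, rfl⟩
  rw [SetLike.mem_coe]
  convert prod_mem_poly e (fun i => (bary T i : E d → ℝ) ^ α i) α
    (fun i _ => pow_mem_poly (bary_mem_poly T i) _) using 1
  funext x
  simp

/-- Writing `1 = (∑ λ_i)^n` is what permits homogenization in barycentric coordinates. -/
theorem one_mem_polyExt_univ (n : ℕ) : (1 : E d → ℝ) ∈ PolyExt T Finset.univ n := by
  have h : (1 : E d → ℝ) ∈ PolyExt T Finset.univ 1 := by
    have : (1 : E d → ℝ) = ∑ i, (bary T i : E d → ℝ) := by
      funext x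
      simp [sum_bary]
    rw [this]
    exact Submodule.sum_mem _ fun i _ => bary_mem_polyExt (Finset.mem_univ i)
  simpa using pow_mem_polyExt h n

theorem coordinate_mem_polyExt_univ (j : Fin d) :
    (fun x : E d => x j) ∈ PolyExt T Finset.univ 1 := by
  have : (fun x : E d => x j) = ∑ i, T.points i j • (bary T i : E d → ℝ) := by
    funext x
    conv_lhs => rw [← sum_bary_smul T x]
    simp [mul_comm]
  rw [this]
  exact Submodule.sum_mem _ fun i _ => Submodule.smul_mem _ _ (bary_mem_polyExt (Finset.mem_univ i))

/-- Polynomials of degree at most `n` are homogeneous of degree `n` in all barycentric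
coordinates. -/
theorem poly_le_polyExt_univ (T : Simp d) (n : ℕ) : Poly d n ≤ PolyExt T Finset.univ n := by
  intro f hf
  obtain ⟨P, hP, rfl⟩ := mem_poly_iff.1 hf
  rw [P.as_sum, map_sum]
  refine Submodule.sum_mem _ fun m hm => ?_
  have hdeg : ∑ i, m i ≤ n := by
    refine le_trans ?_ ((MvPolynomial.le_totalDegree hm).trans hP)
    rw [Finsupp.sum_fintype _ _ fun _ => rfl]
  have h1 := prod_mem_polyExt (T := T) (e := Finset.univ) Finset.univ
    (fun i => (fun x : E d => x i) ^ m i) m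
    fun i _ => pow_mem_polyExt (coordinate_mem_polyExt_univ i) _
  -- The missing degree `n - |m|` is supplied by the constant `1` in its homogeneous form.
  have h2 := Submodule.smul_mem _ (P.coeff m)
    (mul_mem_polyExt h1 (one_mem_polyExt_univ (n - ∑ i, m i)))
  rw [← Nat.cast_add, Nat.add_sub_cancel' hdeg] at h2
  convert h2 using 1
  funext x
  rw [evalPoly_apply, MvPolynomial.aeval_monomial, Finsupp.prod_fintype _ _ fun _ => pow_zero _]
  simp

theorem bary_nonneg_of_mem_geom {x : E d} (hx : x ∈ geom T e) (i : Fin (d + 1)) :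
    0 ≤ bary T i x := by
  have hsub : geom T e ⊆ bary T i ⁻¹' Set.Ici 0 := by
    refine convexHull_min ?_ ((convex_Ici 0).affine_preimage _)
    rintro _ ⟨j, -, rfl⟩
    simp only [Set.mem_preimage, bary_point, Set.mem_Ici]
    split_ifs <;> norm_num
  exact hsub hx

theorem bary_eq_zero_of_mem_geom {x : E d} (hx : x ∈ geom T e) {i : Fin (d + 1)} (hi : i ∉ e) :
    bary T i x = 0 := by
  have hsub : geom T e ⊆ bary T i ⁻¹' {0} := by
    refine convexHull_min ?_ ((convex_singleton 0).affine_preimage _)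
    rintro _ ⟨j, hj, rfl⟩
    have : i ≠ j := fun h => hi (h ▸ hj)
    simp [bary_point, this]
  exact hsub hx

theorem mem_geom_of_bary {x : E d} (h0 : ∀ i ∈ e, 0 ≤ bary T i x) (h1 : ∀ i ∉ e, bary T i x = 0) :
    x ∈ geom T e := by
  have hs : ∑ i ∈ e, bary T i x = 1 := by
    rw [← sum_bary T x]
    exact Finset.sum_subset (Finset.subset_univ _) fun i _ hi => h1 i hi
  have hx : ∑ i ∈ e, bary T i x • T.points i = x := by
    conv_rhs => rw [← sum_bary_smul T x]
    exact Finset.sum_subset (Finset.subset_univ _) fun i _ hi => by rw [h1 i hi, zero_smul]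
  rw [← hx]
  exact (convex_convexHull ℝ _).sum_mem h0 hs fun i hi =>
    subset_convexHull ℝ _ (Set.mem_image_of_mem _ hi)

theorem exists_point_of_bary {w : Fin (d + 1) → ℝ} (hw : ∑ i, w i = 1) :
    ∃ x, ∀ i, bary T i x = w i := by
  refine ⟨Finset.univ.affineCombination ℝ (affBasis T) w, fun i => ?_⟩
  exact (affBasis T).coord_apply_combination_of_mem (Finset.mem_univ i) hw

theorem restrict_mem_polyOn {j : ℤ} {p : E d → ℝ} (hp : p ∈ PolyExt T e j) :
    (fun x : geom T e => p x) ∈ PolyOn (geom T e) j :=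
  Submodule.mem_map_of_mem (f := LinearMap.funLeft ℝ ℝ (Subtype.val : geom T e → E d))
    (polyExt_le_poly j hp)

/-- Every polynomial on `e` is the restriction of its Bernstein form. -/
theorem exists_polyExt_of_mem_polyOn {j : ℤ} {q : geom T e → ℝ} (hq : q ∈ PolyOn (geom T e) j) :
    ∃ p ∈ PolyExt T e j, (fun x : geom T e => p x) = q := by
  obtain ⟨f, hf, rfl⟩ := hq
  by_cases hj : 0 ≤ j
  · lift j to ℕ using hj
    have hle : PolyExt T Finset.univ (j : ℤ) ≤
        ((PolyExt T e j).map (LinearMap.funLeft ℝ ℝ (Subtype.val : geom T e → E d))).comap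
          (LinearMap.funLeft ℝ ℝ (Subtype.val : geom T e → E d)) := by
      rw [PolyExt, Submodule.span_le]
      rintro _ ⟨α, hα, rfl⟩
      -- A monomial either involves only the vertices of `e` or has a factor that vanishes on `e`.
      by_cases hsupp : ∀ i ∉ e, α i = 0
      · refine ⟨_, monomial_mem_polyExt (T := T) (e := e) α (j := j) ?_, ?_⟩
        · rw [← hα]
          exact congrArg _ (Finset.sum_subset (Finset.subset_univ _) fun i _ hi => hsupp i hi)
        · funext x
          exact Finset.prod_subset (Finset.subset_univ _) fun i _ hi => by
            rw [hsupp i hi, pow_zero]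
      · push Not at hsupp
        obtain ⟨i, hi, hαi⟩ := hsupp
        refine ⟨0, Submodule.zero_mem _, ?_⟩
        funext x
        refine (Finset.prod_eq_zero (Finset.mem_univ i) ?_).symm
        rw [bary_eq_zero_of_mem_geom x.2 hi, zero_pow hαi]
    obtain ⟨p, hp, h⟩ := hle (poly_le_polyExt_univ T j hf)
    exact ⟨p, hp, h⟩
  · rw [Poly, if_neg hj] at hf
    refine ⟨0, Submodule.zero_mem _, ?_⟩
    rw [(Submodule.mem_bot ℝ).1 hf]
    rfl

/-- Passing to independent variables removes the constraint `∑ λ_i = 1`; homogeneity allows a return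
to it by rescaling. -/
theorem exists_homogeneous_of_mem_polyExt {j : ℤ} {p : E d → ℝ} (hp : p ∈ PolyExt T e j) :
    ∃ P : MvPolynomial e ℝ,
      (∀ (c : ℝ) (y : e → ℝ), P.eval (fun i => c * y i) = c ^ j.toNat * P.eval y) ∧
      ∀ x, p x = P.eval fun i : e => bary T i x := by
  induction hp using Submodule.span_induction with
  | mem p hp =>
    obtain ⟨α, rfl, rfl⟩ := hp
    refine ⟨∏ i : e, MvPolynomial.X i ^ α i, fun c y => ?_, fun x => ?_⟩
    · simp only [map_prod, map_pow, MvPolynomial.eval_X, mul_pow, Finset.prod_mul_distrib,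
        Int.toNat_natCast]
      rw [Finset.prod_pow_eq_pow_sum, Finset.sum_coe_sort e α]
    · simp only [map_prod, map_pow, MvPolynomial.eval_X]
      exact (Finset.prod_coe_sort e fun i => bary T i x ^ α i).symm
  | zero => exact ⟨0, by simp, by simp⟩
  | add p q _ _ hp hq =>
    obtain ⟨P, hP, hP'⟩ := hp
    obtain ⟨Q, hQ, hQ'⟩ := hq
    exact ⟨P + Q, fun c y => by rw [map_add, map_add, hP, hQ, mul_add],
      fun x => by rw [Pi.add_apply, hP', hQ', map_add]⟩
  | smul a p _ hp =>
    obtain ⟨P, hP, hP'⟩ := hp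
    exact ⟨a • P, fun c y => by
      rw [MvPolynomial.smul_eval, MvPolynomial.smul_eval, hP]; ring,
      fun x => by rw [Pi.smul_apply, hP', MvPolynomial.smul_eval, smul_eq_mul]⟩

/-- A Bernstein form that vanishes in the relative interior of `e` is zero. -/
theorem eq_zero_of_mem_polyExt (he : e.Nonempty) {j : ℤ} {p : E d → ℝ} (hp : p ∈ PolyExt T e j)
    (h : ∀ x, (∀ i ∈ e, 0 < bary T i x) → (∀ i ∉ e, bary T i x = 0) → p x = 0) : p = 0 := by
  classical
  obtain ⟨P, hP, hP'⟩ := exists_homogeneous_of_mem_polyExt hp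
  have hP0 : P = 0 := by
    -- It suffices to vanish on the positive orthant, where dividing `y` by its sum `S` gives the
    -- barycentric coordinates of a point in the relative interior of `e`.
    refine MvPolynomial.funext_set (fun _ => Set.Ioi (0 : ℝ)) (fun _ => Set.Ioi_infinite 0) ?_
    intro y hy
    have hy' : ∀ i, 0 < y i := fun i => hy i (Set.mem_univ i)
    have : Nonempty e := he.to_subtype
    set S := ∑ i, y i with hS
    have hS0 : 0 < S := Finset.sum_pos (fun i _ => hy' i) Finset.univ_nonempty
    let w : Fin (d + 1) → ℝ := fun i => if hi : i ∈ e then S⁻¹ * y ⟨i, hi⟩ else 0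
    have hw : ∑ i, w i = 1 := by
      rw [← Finset.sum_subset (Finset.subset_univ e) fun i _ hi => by simp [w, hi],
        ← Finset.sum_coe_sort]
      simp only [w, Finset.coe_mem, dif_pos, Subtype.coe_eta, ← Finset.mul_sum]
      exact inv_mul_cancel₀ hS0.ne'
    obtain ⟨x, hx⟩ := exists_point_of_bary (T := T) hw
    have hpx := h x (fun i hi => by
      rw [hx]
      simp only [w, hi, dif_pos]
      exact mul_pos (inv_pos.2 hS0) (hy' _)) (fun i hi => by simp [hx, w, hi])
    rw [hP'] at hpx
    have hxy : (fun i : e => bary T i x) = fun i => S⁻¹ * y i := by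
      funext i
      simp [hx, w]
    rw [hxy, hP] at hpx
    rw [map_zero]
    exact (mul_eq_zero.1 hpx).resolve_left (pow_ne_zero _ (inv_ne_zero hS0.ne'))
  funext x
  rw [hP', hP0, map_zero]
  rfl

instance (j : ℤ) : FiniteDimensional ℝ (Poly d j) := by
  by_cases hj : 0 ≤ j
  · rw [Poly, if_pos hj]
    infer_instance
  · rw [Poly, if_neg hj]
    infer_instance

instance (j : ℤ) : FiniteDimensional ℝ (PolyExt T e j) :=
  Submodule.finiteDimensional_of_le (polyExt_le_poly j)

end Bernstein

/-! ### The pieces span the polynomial forms -/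

section Pieces

variable {k : ℕ} {T : Simp d} (t : TangentBases T) (r : ℕ)

theorem piece_le_polyForm (I : Index d k) : piece t r I ≤ PolyForm d r k := by
  rintro _ ⟨p, hp, rfl⟩
  refine Submodule.subset_span ⟨bubble T I.e * p, ?_, basisForm t I, rfl⟩
  have := mul_mem_polyExt bubble_mem_polyExt hp
  have hr : (I.e.card : ℤ) + ((r : ℤ) - (I.s + 1)) = r := by
    rw [I.card_e]
    push_cast
    ring
  rw [hr] at this
  exact polyExt_le_poly r this

/-- Bernstein monomials on `T` are sorted by their support `e`. One power of each `λ_i`, `i ∈ e`,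
makes up `b_e`, and the constant form is expanded in the basis belonging to that `e`. -/
theorem polyForm_le_iSup_piece (hr : 1 ≤ r) : PolyForm d r k ≤ ⨆ I, piece t r I := by
  classical
  rw [PolyForm, Submodule.span_le]
  rintro _ ⟨f, hf, η, rfl⟩
  let Φ : (E d → ℝ) →ₗ[ℝ] (E d → Alt d k) :=
    { toFun := fun f x => f x • η
      map_add' := fun f g => by funext x; simp [add_smul]
      map_smul' := fun c f => by funext x; simp [smul_smul] }
  have hle : PolyExt T Finset.univ r ≤ (⨆ I, piece t r I).comap Φ := by
    rw [PolyExt, Submodule.span_le]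
    rintro _ ⟨α, hα, rfl⟩
    have hα' : ∑ i, α i = r := by exact_mod_cast hα
    let e := Finset.univ.filter fun i => α i ≠ 0
    have hsum : ∑ i ∈ e, α i = r := by
      rw [← hα']
      exact Finset.sum_filter_ne_zero _
    -- An empty support would force `r = 0`.
    have hne : e.Nonempty := by
      rw [Finset.nonempty_iff_ne_empty]
      intro h
      rw [h, Finset.sum_empty] at hsum
      omega
    have he : e.card = (e.card - 1) + 1 := by
      have := hne.card_pos
      omega
    have hsum' : ∑ i ∈ e, (α i - 1) + e.card = r := by
      rw [← hsum, Finset.card_eq_sum_ones, ← Finset.sum_add_distrib]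
      refine Finset.sum_congr rfl fun i hi => ?_
      have : α i ≠ 0 := (Finset.mem_filter.1 hi).2
      omega
    have := Fintype.ofFinite {I : Index d k // I.e = e}
    obtain ⟨c, hc⟩ := exists_eq_sum_basisForm t he η
    have hΦ : Φ (fun x => ∏ i, bary T i x ^ α i) = ∑ I : {I : Index d k // I.e = e}, c I •
        bubbleMul T I.1.e (basisForm t I.1) fun x => ∏ i ∈ I.1.e, bary T i x ^ (α i - 1) := by
      funext x
      have hprod : ∏ i, bary T i x ^ α i = bubble T e x * ∏ i ∈ e, bary T i x ^ (α i - 1) := by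
        rw [bubble, ← Finset.prod_mul_distrib, ← Finset.prod_subset (Finset.subset_univ e)]
        · refine Finset.prod_congr rfl fun i hi => ?_
          rw [← pow_succ', Nat.sub_add_cancel
            (Nat.one_le_iff_ne_zero.2 (Finset.mem_filter.1 hi).2)]
        · intro i _ hi
          have : α i = 0 := by simpa [e] using hi
          rw [this, pow_zero]
      rw [Finset.sum_apply]
      change (∏ i, bary T i x ^ α i) • η = _
      rw [hprod]
      nth_rewrite 1 [hc]
      rw [Finset.smul_sum]
      refine Finset.sum_congr rfl fun I _ => ?_
      rw [smul_comm]
      simp [bubbleMul, I.2]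
    rw [SetLike.mem_coe, Submodule.mem_comap, hΦ]
    refine Submodule.sum_mem _ fun I _ => Submodule.smul_mem _ _
      (Submodule.mem_iSup_of_mem I.1 (Submodule.mem_map_of_mem (monomial_mem_polyExt _ ?_)))
    have hs := I.1.card_e
    rw [I.2] at hs ⊢
    rw [hs] at hsum'
    rw [← hsum']
    push_cast
    ring
  exact hle (poly_le_polyExt_univ T r hf)

end Pieces

end

end GeoDec

/-! ### Surface measure on sub-simplices -/

namespace GeoDec

noncomputable section

variable {d : ℕ} {T : Simp d} {s : ℕ} {e : Finset (Fin (d + 1))}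

theorem isCompact_geom (T : Simp d) (e : Finset (Fin (d + 1))) : IsCompact (geom T e) :=
  ((Set.toFinite _).image _).isCompact_convexHull ℝ

instance : CompactSpace (geom T e) := isCompact_iff_compactSpace.1 (isCompact_geom T e)

theorem finrank_tangent (he : e.card = s + 1) : Module.finrank ℝ (tangent T e) = s := by
  classical
  have := T.independent.finrank_vectorSpan_image_finset (s := e) he
  rw [Finset.coe_image] at this
  exact this

/-- The affine hull of a sub-simplex of dimension `s` is the isometric image of `ℝ^s`. -/
theorem exists_isometry (T : Simp d) (he : e.card = s + 1) :
    ∃ ι : EuclideanSpace ℝ (Fin s) → E d, Isometry ι ∧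
      (∀ y, ∀ j ∉ e, bary T j (ι y) = 0) ∧
      ∀ x, (∀ j ∉ e, bary T j x = 0) → x ∈ Set.range ι := by
  have hne : e.Nonempty := Finset.card_pos.1 (by omega)
  obtain ⟨i, hi⟩ := hne
  let b := (stdOrthonormalBasis ℝ (tangent T e)).reindex (finCongr (finrank_tangent he))
  have hbary : ∀ j ∉ e, bary T j (T.points i) = 0 := fun j hj => by
    have : j ≠ i := fun h => hj (h ▸ hi)
    simp [bary_point, this]
  refine ⟨fun y => ((b.repr.symm y : tangent T e) : E d) + T.points i, ?_, fun y j hj => ?_,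
    fun x hx => ?_⟩
  · exact (IsometryEquiv.addRight (T.points i)).isometry.comp
      (isometry_subtype_coe.comp b.repr.symm.isometry)
  · have h := dBary_eq_zero_of_mem_tangent (b.repr.symm y).2 hj
    have h2 := dBary_sub T j (((b.repr.symm y : tangent T e) : E d) + T.points i) (T.points i)
    rw [add_sub_cancel_right, h, hbary j hj, sub_zero] at h2
    exact h2.symm
  · have hmem : x - T.points i ∈ tangent T e :=
      (mem_tangent_iff ⟨i, hi⟩).2 fun j hj => by rw [dBary_sub, hx j hj, hbary j hj, sub_zero]
    exact ⟨b.repr ⟨_, hmem⟩, by simp⟩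

/-- Under an isometry from `ℝ^s`, the surface measure becomes Lebesgue measure of a bounded set. -/
theorem isFiniteMeasure_geom (T : Simp d) (he : e.card = s + 1) :
    IsFiniteMeasure (μHE[s] : Measure (geom T e)) := by
  obtain ⟨ι, hι, -, hrange⟩ := exists_isometry T he
  refine ⟨?_⟩
  have h1 : (μHE[s] : Measure (geom T e)) Set.univ = (μHE[s] : Measure (E d)) (geom T e) := by
    rw [← (isometry_subtype_coe (s := geom T e)).euclideanHausdorffMeasure_image, Set.image_univ,
      Subtype.range_coe]
  have hsub : geom T e ⊆ Set.range ι := fun x hx =>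
    hrange x fun j hj => bary_eq_zero_of_mem_geom hx hj
  rw [h1, ← Set.image_preimage_eq_of_subset hsub, hι.euclideanHausdorffMeasure_image,
    EuclideanSpace.euclideanHausdorffMeasure_eq_volume]
  exact (hι.antilipschitz.isBounded_preimage (isCompact_geom T e).isBounded).measure_lt_top

/-- Nonempty relatively open subsets of the relative interior of `e` have positive measure. -/
theorem measure_pos_of_isOpen (he : e.card = s + 1) {V : Set (geom T e)} (hV : IsOpen V)
    (hV0 : ∀ x ∈ V, ∀ i ∈ e, 0 < bary T i x) (hne : V.Nonempty) :
    0 < (μHE[s] : Measure (geom T e)) V := by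
  obtain ⟨ι, hι, hzero, hrange⟩ := exists_isometry T he
  obtain ⟨O, hO, rfl⟩ := isOpen_induced_iff.1 hV
  have hsub : geom T e ∩ O ⊆ Set.range ι := fun x hx =>
    hrange x fun j hj => bary_eq_zero_of_mem_geom hx.1 hj
  rw [← (isometry_subtype_coe (s := geom T e)).euclideanHausdorffMeasure_image,
    Subtype.image_preimage_coe, ← Set.image_preimage_eq_of_subset hsub,
    hι.euclideanHausdorffMeasure_image, EuclideanSpace.euclideanHausdorffMeasure_eq_volume]
  -- On the range of `ι` the coordinates outside `e` vanish, so strict positivity of the others can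
  -- replace membership in the closed simplex; this makes the preimage open.
  have hW : ι ⁻¹' (geom T e ∩ O) = ι ⁻¹' (O ∩ ⋂ i ∈ e, {x | 0 < bary T i x}) := by
    ext y
    simp only [Set.mem_preimage, Set.mem_inter_iff, Set.mem_iInter, Set.mem_ofPred_eq]
    constructor
    · rintro ⟨h1, h2⟩
      exact ⟨h2, hV0 ⟨_, h1⟩ h2⟩
    · rintro ⟨h1, h2⟩
      exact ⟨mem_geom_of_bary (fun i hi => (h2 i hi).le) (hzero y), h1⟩
  have hWo : IsOpen (ι ⁻¹' (geom T e ∩ O)) := by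
    rw [hW]
    refine (hO.inter (isOpen_biInter_finset fun i _ => ?_)).preimage hι.continuous
    exact isOpen_lt continuous_const (continuous_bary T i)
  refine hWo.measure_pos _ ?_
  obtain ⟨x, hx⟩ := hne
  obtain ⟨y, hy⟩ := hsub ⟨x.2, hx⟩
  exact ⟨y, by rw [Set.mem_preimage, hy]; exact ⟨x.2, hx⟩⟩

theorem integrable_geom (he : e.card = s + 1) {f : geom T e → ℝ} (hf : Continuous f) :
    Integrable f (μHE[s] : Measure (geom T e)) := by
  have := isFiniteMeasure_geom T he
  exact hf.integrable_of_hasCompactSupport (HasCompactSupport.of_compactSpace f)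

theorem continuous_of_mem_polyExt {j : ℤ} {p : E d → ℝ} (hp : p ∈ PolyExt T e j) : Continuous p :=
  continuous_of_mem_poly (polyExt_le_poly j hp)

theorem continuous_bubble : Continuous (bubble T e) :=
  continuous_of_mem_polyExt bubble_mem_polyExt

/-- The form `(p, q) ↦ ∫_e b_e p q ds` is definite. -/
theorem eq_zero_of_integral_bubble_mul_sq (he : e.card = s + 1) {j : ℤ} {p : E d → ℝ}
    (hp : p ∈ PolyExt T e j)
    (h : ∫ x : geom T e, bubble T e x * p x * p x ∂μHE[s] = 0) : p = 0 := by
  have hcont : Continuous fun x : geom T e => bubble T e x * p x * p x := by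
    have h1 := continuous_of_mem_polyExt hp
    have h2 := continuous_bubble (T := T) (e := e)
    fun_prop
  have hnn : 0 ≤ fun x : geom T e => bubble T e x * p x * p x := fun x => by
    simp only [Pi.zero_apply, mul_assoc]
    exact mul_nonneg (Finset.prod_nonneg fun i _ => bary_nonneg_of_mem_geom x.2 i)
      (mul_self_nonneg _)
  rw [integral_eq_zero_iff_of_nonneg hnn (integrable_geom he hcont)] at h
  refine eq_zero_of_mem_polyExt (Finset.card_pos.1 (by omega)) hp fun x hx0 hx1 => ?_
  by_contra hpx
  have hmem : x ∈ geom T e := mem_geom_of_bary (fun i hi => (hx0 i hi).le) hx1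
  -- The set where the integrand is nonzero avoids the zeros of `b_e`, hence lies in the relative
  -- interior.
  have hpos := measure_pos_of_isOpen he (T := T)
    (V := {x : geom T e | bubble T e x * p x * p x ≠ 0}) (isOpen_ne_fun hcont continuous_const)
    (fun y hy i hi => ?_) ⟨⟨x, hmem⟩, ?_⟩
  · exact hpos.ne' (ae_iff.1 h)
  · refine lt_of_le_of_ne (bary_nonneg_of_mem_geom y.2 i) fun h0 => hy ?_
    rw [bubble, Finset.prod_eq_zero hi h0.symm, zero_mul, zero_mul]
  · have : bubble T e x ≠ 0 := (Finset.prod_pos hx0).ne'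
    simp [this, hpx]

end

end GeoDec

namespace GeoDec

noncomputable section

variable {d k : ℕ} {T : Simp d} (t : TangentBases T) {r : ℕ}

/-! ### Degrees of freedom as linear functionals -/

section DegreesOfFreedom

theorem continuous_altInner {ω : E d → Alt d k} (hω : ω ∈ PolyForm d r k) (η : Alt d k) :
    Continuous fun x => altInner (ω x) η := by
  induction hω using Submodule.span_induction with
  | mem ω h =>
    obtain ⟨p, hp, ζ, rfl⟩ := h
    simp only [altInner_smul_left]
    exact (continuous_of_mem_poly hp).mul continuous_const
  | zero => simpa [altInner] using continuous_const
  | add ω ω' _ _ h h' =>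
    simp only [Pi.add_apply, altInner_add_left]
    exact h.add h'
  | smul c ω _ h =>
    simp only [Pi.smul_apply, altInner_smul_left]
    exact continuous_const.mul h

theorem continuous_of_mem_polyOn {Ω : Set (E d)} {j : ℤ} {q : Ω → ℝ} (hq : q ∈ PolyOn Ω j) :
    Continuous q := by
  obtain ⟨f, hf, rfl⟩ := hq
  exact (continuous_of_mem_poly hf).comp continuous_subtype_val

theorem integrable_dof {s : ℕ} {e : Finset (Fin (d + 1))} (he : e.card = s + 1)
    {ω : E d → Alt d k} (hω : ω ∈ PolyForm d r k) (η : Alt d k) {j : ℤ} {q : geom T e → ℝ}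
    (hq : q ∈ PolyOn (geom T e) j) :
    Integrable (fun x : geom T e => altInner (ω x) η * q x) μHE[s] :=
  integrable_geom he (((continuous_altInner hω η).comp continuous_subtype_val).mul
    (continuous_of_mem_polyOn hq))

/-- The degrees of freedom attached to `I`, as a bilinear map. -/
def dofMap (r : ℕ) (I : Index d k) : PolyForm d r k →ₗ[ℝ]
    Module.Dual ℝ (PolyOn (geom T I.e) ((r : ℤ) - (I.s + 1))) :=
  LinearMap.mk₂ ℝ (fun ω q => dof t I ω q)
    (fun ω ω' q => by
      simp only [dof, Submodule.coe_add, Pi.add_apply, altInner_add_left, add_mul]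
      exact integral_add (integrable_dof I.card_e ω.2 _ q.2) (integrable_dof I.card_e ω'.2 _ q.2))
    (fun c ω q => by
      simp only [dof, Submodule.coe_smul, Pi.smul_apply, altInner_smul_left, mul_assoc, smul_eq_mul]
      exact integral_const_mul _ _)
    (fun ω q q' => by
      simp only [dof, Submodule.coe_add, Pi.add_apply, mul_add]
      exact integral_add (integrable_dof I.card_e ω.2 _ q.2) (integrable_dof I.card_e ω.2 _ q'.2))
    (fun c ω q => by
      simp only [dof, Submodule.coe_smul, Pi.smul_apply, smul_eq_mul, mul_left_comm _ c]
      exact integral_const_mul _ _)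

/-- If the degrees of freedom of `ω` on `e` vanish, then so do all moments of `ω` on `e`. -/
theorem integral_altInner_eq_zero {ω : PolyForm d r k} (hω : ∀ I, dofMap t r I ω = 0) {s : ℕ}
    {e : Finset (Fin (d + 1))} (he : e.card = s + 1) (η : Alt d k) {q : E d → ℝ}
    (hq : q ∈ PolyExt T e ((r : ℤ) - (s + 1))) :
    ∫ x : geom T e, altInner ((ω : E d → Alt d k) x) η * q x ∂μHE[s] = 0 := by
  have := Fintype.ofFinite {I : Index d k // I.e = e}
  have key : ∀ I : {I : Index d k // I.e = e},
      ∫ x : geom T e, altInner ((ω : E d → Alt d k) x) (dualForm t I.1) * q x ∂μHE[s] = 0 := by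
    rintro ⟨I, rfl⟩
    obtain rfl := Index.s_eq he rfl
    exact LinearMap.congr_fun (hω I) ⟨_, restrict_mem_polyOn hq⟩
  obtain ⟨c, rfl⟩ := exists_eq_sum_dualForm t he η
  simp only [altInner_sum_right, Finset.sum_mul, mul_assoc]
  rw [integral_finsetSum _ fun I _ =>
    (integrable_dof he ω.2 _ (restrict_mem_polyOn hq)).const_mul _]
  simp [integral_const_mul, key]

end DegreesOfFreedom

/-! ### Unisolvence and directness -/

section Assemble

instance : Fintype (Index d k) := Fintype.ofFinite _

/-- The sum of the forms `b_e p_I d♭ t^e_σ ∧ dλ_{[f \ e]}` over all indices. -/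
def assemble (r : ℕ) :
    ((I : Index d k) → PolyExt T I.e ((r : ℤ) - (I.s + 1))) →ₗ[ℝ] PolyForm d r k :=
  LinearMap.codRestrict _
    (∑ I, bubbleMul T I.e (basisForm t I) ∘ₗ Submodule.subtype _ ∘ₗ LinearMap.proj I)
    (fun p => by
      rw [LinearMap.sum_apply]
      exact Submodule.sum_mem _ fun I _ =>
        piece_le_polyForm t r I (Submodule.mem_map_of_mem (p I).2))

theorem coe_assemble (p : (I : Index d k) → PolyExt T I.e ((r : ℤ) - (I.s + 1))) :
    (assemble t r p : E d → Alt d k) =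
      ∑ I, bubbleMul T I.e (basisForm t I) (p I : E d → ℝ) := by
  simp [assemble]

theorem assemble_apply (p : (I : Index d k) → PolyExt T I.e ((r : ℤ) - (I.s + 1))) (x : E d) :
    (assemble t r p : E d → Alt d k) x =
      ∑ I, (bubble T I.e x * (p I : E d → ℝ) x) • basisForm t I := by
  rw [coe_assemble, Finset.sum_apply]
  rfl

/-- On `e`, only the terms of `e` contribute if the terms of the proper faces of `e` vanish. -/
theorem assemble_apply_of_mem_geom {e : Finset (Fin (d + 1))}
    [Fintype {I : Index d k // I.e = e}]
    (p : (I : Index d k) → PolyExt T I.e ((r : ℤ) - (I.s + 1)))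
    (hp : ∀ I : Index d k, I.e ⊂ e → p I = 0) {x : E d} (hx : x ∈ geom T e) :
    (assemble t r p : E d → Alt d k) x =
      bubble T e x • ∑ I : {I : Index d k // I.e = e}, (p I.1 : E d → ℝ) x • basisForm t I.1 := by
  classical
  rw [assemble_apply, ← Fintype.sum_subtype_add_sum_subtype (fun I : Index d k => I.e = e),
    Finset.smul_sum]
  have hrest : ∑ I : {I : Index d k // ¬I.e = e},
      (bubble T I.1.e x * (p I.1 : E d → ℝ) x) • basisForm t I.1 = 0 := by
    refine Finset.sum_eq_zero ?_
    rintro ⟨I, hI⟩ -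
    by_cases hsub : I.e ⊆ e
    · simp [hp I (hsub.ssubset_of_ne hI)]
    -- A vertex of `I.e` outside `e` contributes to the bubble a factor that vanishes on `e`.
    · obtain ⟨i, hi, hie⟩ := Finset.not_subset.1 hsub
      have : bubble T I.e x = 0 := Finset.prod_eq_zero hi (bary_eq_zero_of_mem_geom hx hie)
      simp [this]
  rw [hrest, add_zero]
  refine Finset.sum_congr (by ext; simp) fun I _ => ?_
  have hb : bubble T I.1.e x = bubble T e x := by rw [I.2]
  rw [hb, mul_smul]

/-- Strong induction on the number of vertices makes the system triangular: on `e` only the unknowns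
of `e` are left, weighted by `b_e`. -/
theorem eq_zero_of_dofMap_assemble (p : (I : Index d k) → PolyExt T I.e ((r : ℤ) - (I.s + 1)))
    (h : ∀ I, dofMap t r I (assemble t r p) = 0) : p = 0 := by
  suffices hmain : ∀ n, ∀ I : Index d k, I.e.card = n → p I = 0 from
    funext fun I => hmain _ I rfl
  intro n
  induction n using Nat.strong_induction_on with
  | h n ih =>
    intro I₀ hn
    set e := I₀.e with he
    have hcard : e.card = I₀.s + 1 := I₀.card_e
    have := Fintype.ofFinite {I : Index d k // I.e = e}
    have hω := fun x (hx : x ∈ geom T e) => assemble_apply_of_mem_geom t p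
      (fun I hI => ih _ (hn ▸ Finset.card_lt_card hI) I rfl) hx
    let c : (Fin k ↪o Fin d) → E d → ℝ := fun σ =>
      ∑ I : {I : Index d k // I.e = e}, basisForm t I.1 (stdTuple σ) • (p I.1 : E d → ℝ)
    have hc_mem : ∀ σ, c σ ∈ PolyExt T e ((r : ℤ) - (I₀.s + 1)) := fun σ => by
      refine Submodule.sum_mem _ fun I _ => Submodule.smul_mem _ _ ?_
      have hle : PolyExt T I.1.e ((r : ℤ) - (I.1.s + 1)) ≤ PolyExt T e ((r : ℤ) - (I₀.s + 1)) := by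
        rw [Index.s_eq hcard I.2, I.2]
      exact hle (p I.1).2
    have hsum : ∀ σ x, (∑ I : {I : Index d k // I.e = e},
        (p I.1 : E d → ℝ) x • basisForm t I.1) (stdTuple σ) = c σ x := fun σ x => by
      rw [sum_smul_apply]
      simp only [c]
      rw [Finset.sum_apply]
      exact Finset.sum_congr rfl fun I _ => mul_comm _ _
    have hc : ∀ σ, c σ = 0 := fun σ => by
      -- The component `c σ` is itself an admissible test function.
      refine eq_zero_of_integral_bubble_mul_sq hcard (hc_mem σ) ?_
      rw [← integral_altInner_eq_zero t h hcard (stdForm σ) (hc_mem σ)]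
      refine integral_congr_ae (Filter.Eventually.of_forall fun x => ?_)
      simp only
      rw [altInner_stdForm, hω x x.2, AlternatingMap.smul_apply, hsum, smul_eq_mul]
    refine Subtype.ext (funext fun x => ?_)
    -- Each `c σ` vanishes on all of `ℝ^d`, so independence of the constant forms applies at every
    -- `x`.
    refine eq_zero_of_sum_basisForm t hcard (fun I => (p I.1 : E d → ℝ) x) ?_ ⟨I₀, rfl⟩
    refine ext_stdTuple fun σ => ?_
    rw [hsum, hc]
    rfl

theorem assemble_surjective (hr : 1 ≤ r) : Function.Surjective (assemble (k := k) t r) := by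
  classical
  rintro ⟨ω, hω⟩
  have hle : ⨆ I : Index d k, piece t r I ≤
      LinearMap.range ((PolyForm d r k).subtype ∘ₗ assemble t r) := by
    refine iSup_le fun I => ?_
    rintro _ ⟨p, hp, rfl⟩
    refine ⟨Pi.single I ⟨p, hp⟩, ?_⟩
    rw [LinearMap.comp_apply, Submodule.subtype_apply, coe_assemble, Finset.sum_eq_single I]
    · simp
    · intro J _ hJ
      simp [Pi.single_eq_of_ne hJ]
    · simp
  obtain ⟨p, hp⟩ := hle (polyForm_le_iSup_piece t r hr hω)
  exact ⟨p, Subtype.ext hp⟩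

/-- Restriction maps Bernstein forms onto polynomials on `e`; this one inequality suffices for the
dimension count. -/
theorem finrank_polyOn_le (e : Finset (Fin (d + 1))) (j : ℤ) :
    Module.finrank ℝ (PolyOn (geom T e) j) ≤ Module.finrank ℝ (PolyExt T e j) := by
  have hle : PolyOn (geom T e) j ≤
      (PolyExt T e j).map (LinearMap.funLeft ℝ ℝ (Subtype.val : geom T e → E d)) := fun q hq => by
    obtain ⟨p, hp, h⟩ := exists_polyExt_of_mem_polyOn hq
    exact ⟨p, hp, h⟩
  exact (Submodule.finrank_mono hle).trans (Submodule.finrank_map_le _ _)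

instance (Ω : Set (E d)) (j : ℤ) : FiniteDimensional ℝ (PolyOn Ω j) := by
  unfold PolyOn
  infer_instance

theorem dofMap_assemble_injective : Function.Injective
    (LinearMap.pi (fun I : Index d k => dofMap t r I) ∘ₗ assemble t r) := by
  rw [← LinearMap.ker_eq_bot, LinearMap.ker_eq_bot']
  exact fun p hp => eq_zero_of_dofMap_assemble t p fun I => congrFun hp I

/-- An injective map into a space of no larger dimension is onto. -/
theorem dofMap_assemble_surjective : Function.Surjective
    (LinearMap.pi (fun I : Index d k => dofMap t r I) ∘ₗ assemble t r) := by
  rw [← LinearMap.range_eq_top]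
  refine Submodule.eq_top_of_finrank_eq (le_antisymm (Submodule.finrank_le _) ?_)
  rw [LinearMap.finrank_range_of_inj (dofMap_assemble_injective t),
    Module.finrank_pi_fintype, Module.finrank_pi_fintype]
  refine Finset.sum_le_sum fun I _ => ?_
  rw [Subspace.dual_finrank_eq]
  exact finrank_polyOn_le _ _

/-- A vanishing sum of elements of the pieces is an assembled tuple, extended by zero off `S`, whose
degrees of freedom are all zero. -/
theorem iSupIndep_piece : iSupIndep fun I : Index d k => piece t r I := by
  classical
  rw [iSupIndep_iff_finsetSum_eq_zero_imp_eq_zero]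
  intro S v hv hsum
  choose! p hp hpv using hv
  let P : (I : Index d k) → PolyExt T I.e ((r : ℤ) - (I.s + 1)) := fun I =>
    if hI : I ∈ S then ⟨p I, hp I hI⟩ else 0
  have hP : assemble t r P = 0 := by
    refine Subtype.ext ?_
    rw [coe_assemble, ← Finset.sum_subset (Finset.subset_univ S) fun I _ hI => by simp [P, hI],
      Submodule.coe_zero, ← hsum]
    refine Finset.sum_congr rfl fun I hI => ?_
    simp only [P, dif_pos hI]
    exact hpv I hI
  have hP0 : P = 0 := eq_zero_of_dofMap_assemble t P fun I => by rw [hP, map_zero]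
  intro I hI
  have hPI : p I = 0 := by
    have := congrFun hP0 I
    simp only [P, dif_pos hI] at this
    exact congrArg Subtype.val this
  rw [← hpv I hI, hPI, map_zero]

end Assemble

end

end GeoDec

theorem theorem5p2 (d k r : ℕ) (hk : k < d) (hr : 1 ≤ r) (T : GeoDec.Simp d)
    (t : GeoDec.TangentBases T) :
    -- the geometric decomposition: the sum of the pieces is direct and is all of `P_r Λ^k(T)`
    (iSupIndep (fun I : GeoDec.Index d k => GeoDec.piece t r I) ∧
      ⨆ I : GeoDec.Index d k, GeoDec.piece t r I = GeoDec.PolyForm d r k) ∧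
    -- a form is determined by its degrees of freedom
    (∀ ω₁ ∈ GeoDec.PolyForm d r k, ∀ ω₂ ∈ GeoDec.PolyForm d r k,
      (∀ (I : GeoDec.Index d k), ∀ q ∈ GeoDec.PolyOn (GeoDec.geom T I.e) ((r : ℤ) - (I.s + 1)),
        GeoDec.dof t I ω₁ q = GeoDec.dof t I ω₂ q) → ω₁ = ω₂) ∧
    -- the degrees of freedom can be prescribed arbitrarily
    (∀ L : ∀ I : GeoDec.Index d k,
        GeoDec.PolyOn (GeoDec.geom T I.e) ((r : ℤ) - (I.s + 1)) →ₗ[ℝ] ℝ,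
      ∃ ω ∈ GeoDec.PolyForm d r k, ∀ (I : GeoDec.Index d k)
        (q : GeoDec.PolyOn (GeoDec.geom T I.e) ((r : ℤ) - (I.s + 1))),
        GeoDec.dof t I ω q = L I q) := by
  refine ⟨⟨GeoDec.iSupIndep_piece t, le_antisymm (iSup_le fun I => GeoDec.piece_le_polyForm t r I)
    (GeoDec.polyForm_le_iSup_piece t r hr)⟩, fun ω₁ h₁ ω₂ h₂ h => ?_, fun L => ?_⟩
  -- Every form is assembled from some tuple, so injectivity on tuples passes to forms.
  · obtain ⟨p₁, hp₁⟩ := GeoDec.assemble_surjective t hr ⟨ω₁, h₁⟩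
    obtain ⟨p₂, hp₂⟩ := GeoDec.assemble_surjective t hr ⟨ω₂, h₂⟩
    have hp : p₁ = p₂ := by
      refine GeoDec.dofMap_assemble_injective t (funext fun I => LinearMap.ext fun q => ?_)
      change GeoDec.dofMap t r I (GeoDec.assemble t r p₁) q =
        GeoDec.dofMap t r I (GeoDec.assemble t r p₂) q
      rw [hp₁, hp₂]
      exact h I q q.2
    rw [hp, hp₂] at hp₁
    exact (congrArg Subtype.val hp₁).symm
  · obtain ⟨p, hp⟩ := GeoDec.dofMap_assemble_surjective t L
    exact ⟨_, (GeoDec.assemble t r p).2, fun I q => LinearMap.congr_fun (congrFun hp I) q⟩
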